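/- Let $0<q<1$, $\mu>0$, and write $(a;q)_k=\prod_{j=0}^{k-1}(1-aq^j)$, $(a;q)_\infty=\prod_{j\ge 0}(1-aq^j)$, $(a_1,\dots,a_m;q)_k=\prod_i (a_i;q)_k$ (also for $k=\infty$), and $${}_3\varphi_2\left(\begin{matrix}a,b,c\\ d,e\end{matrix};q,z\right)=\sum_{k\ge 0}\frac{(a,b,c;q)_k}{(q,d,e;q)_k}\,z^k .$$ If the numerator of a terminating series vanishes for all large $k$ because of $a$ or $b$, only the terms with $(a,b;q)_k\neq 0$ are summed. Let $u_n=u_n^{\mu}(x;q)$ be the Al-Salam–Carlitz polynomials, defined by $u_0=1$, $u_1=\mu^{-1}(x-1+\mu)$ and $$\mu q^{n}u_{n+1}+(1-q^n)u_{n-1}=\bigl(x-(1-\mu)q^n\bigr)u_n\qquad(n\ge 1).$$ Put $$\tilde\rho(x)=\frac{(qx,-\mu^{-1}qx;q)_\infty}{(q,-\mu,-q/\mu;q)_\infty},\qquad d_n^2=q^{-n(n-1)/2}\frac{(q;q)_n}{\mu^n},\qquad \tilde\psi_n(x)=d_n^{-1}\bigl(\tilde\rho(x)|x|\bigr)^{1/2}u_n^\mu(x;q),$$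 and $K_t(x,y)=\sum_{n\ge 0}t^n\tilde\psi_n(x)\tilde\psi_n(y)$. Let $t\in\mathbb C\setminus\{0\}$, let $s\ge 0$ be an integer, and let $y\in\{q^r,-\mu q^r: r=0,1,2,\dots\}$. (i) Let $x=q^s$. Suppose that the denominators below do not vanish, that is, $(tx,ty;q)_\infty\ne 0$ and $(q(tx)^{-1},q(ty)^{-1};q)_k\neq 0$ for every $k\ge 0$ with $(x^{-1},y^{-1};q)_k\ne 0$. Then the series $K_t(x,y)$ converges absolutely and $$K_t(x,y)=\bigl(\tilde\rho(x)\tilde\rho(y)|xy|\bigr)^{1/2}\,\frac{(t,t,-\mu t;q)_\infty}{(tx,ty;q)_\infty}\;{}_3\varphi_2\left(\begin{matrix}x^{-1},\,y^{-1},\,-q(\mu t)^{-1}\\ q(tx)^{-1},\,q(ty)^{-1}\end{matrix};q,q\right).$$ (ii) Let $x=-\mu q^s$. Suppose that $(-\mu^{-1}tx,-\mu^{-1}ty;q)_\infty\ne 0$ and $(-q\mu(tx)^{-1},-q\mu(ty)^{-1};q)_k\neq 0$ for every $k\ge 0$ with $(-\mu x^{-1},-\mu y^{-1};q)_k\ne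 0$. Then the series $K_t(x,y)$ converges absolutely and $$K_t(x,y)=\bigl(\tilde\rho(x)\tilde\rho(y)|xy|\bigr)^{1/2}\,\frac{(t,t,-\mu^{-1}t;q)_\infty}{(-\mu^{-1}tx,-\mu^{-1}ty;q)_\infty}\;{}_3\varphi_2\left(\begin{matrix}-\mu x^{-1},\,-\mu y^{-1},\,-q\mu t^{-1}\\ -q\mu(tx)^{-1},\,-q\mu(ty)^{-1}\end{matrix};q,q\right).$$ -/

import Mathlib

noncomputable section

namespace AlSalamCarlitz

/-- The finite `q`-shifted factorial `(a;q)_n = ∏_{k<n} (1 - a q^k)`. -/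
def qPoch {𝕜 : Type*} [NormedField 𝕜] (a q : 𝕜) (n : ℕ) : 𝕜 :=
  ∏ k ∈ Finset.range n, (1 - a * q ^ k)

/-- The infinite `q`-shifted factorial `(a;q)_∞ = ∏_{k≥0} (1 - a q^k)`
(the product converges absolutely for `|q| < 1`). -/
def qPochInf {𝕜 : Type*} [NormedField 𝕜] (a q : 𝕜) : 𝕜 :=
  ∏' k : ℕ, (1 - a * q ^ k)

/-- The basic hypergeometric series `₃φ₂(a, b, c; d, e; q, z)`. -/
def phi32 (a b c d e q z : ℂ) : ℂ :=
  ∑' k : ℕ, qPoch a q k * qPoch b q k * qPoch c q k /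
    (qPoch q q k * qPoch d q k * qPoch e q k) * z ^ k

/-- The Al-Salam and Carlitz polynomials `u_n^μ(x;q)`, given by `u_0 = 1`, `u_1 = μ⁻¹ (x - 1 + μ)`
and `μ q^n u_{n+1} + (1 - q^n) u_{n-1} = (x - (1 - μ) q^n) u_n` for `n ≥ 1`. -/
def acPoly (μ q x : ℝ) : ℕ → ℝ
  | 0 => 1
  | 1 => μ⁻¹ * (x - 1 + μ)
  | n + 2 => ((x - (1 - μ) * q ^ (n + 1)) * acPoly μ q x (n + 1)
      - (1 - q ^ (n + 1)) * acPoly μ q x n) / (μ * q ^ (n + 1))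

/-- The weight `ρ̃(x) = (qx, -μ⁻¹qx; q)_∞ / (q, -μ, -q/μ; q)_∞`. -/
def weight (μ q x : ℝ) : ℝ :=
  qPochInf (q * x) q * qPochInf (-(μ⁻¹ * q * x)) q /
    (qPochInf q q * qPochInf (-μ) q * qPochInf (-(q / μ)) q)

/-- The squared norm `d_n² = q^{-n(n-1)/2} (q;q)_n / μ^n`. -/
def normSq (μ q : ℝ) (n : ℕ) : ℝ :=
  (q ^ (n * (n - 1) / 2))⁻¹ * (qPoch q q n / μ ^ n)

/-- The `q`-wave functions `ψ̃_n(x) = d_n⁻¹ (ρ̃(x)|x|)^{1/2} u_n^μ(x;q)`. -/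
def waveFn (μ q : ℝ) (n : ℕ) (x : ℝ) : ℝ :=
  (√(normSq μ q n))⁻¹ * √(weight μ q x * |x|) * acPoly μ q x n

/-- The `n`-th term `t^n ψ̃_n(x) ψ̃_n(y)` of the kernel. -/
def kernelTerm (μ q : ℝ) (t : ℂ) (x y : ℝ) (n : ℕ) : ℂ :=
  t ^ n * (waveFn μ q n x : ℂ) * (waveFn μ q n y : ℂ)

/-- The kernel `K_t(x,y) = ∑_{n≥0} t^n ψ̃_n(x) ψ̃_n(y)`. -/
def qKernel (μ q : ℝ) (t : ℂ) (x y : ℝ) : ℂ :=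
  ∑' n : ℕ, kernelTerm μ q t x y n

/-- The set `{q^r} ∪ {-μ q^r}`, `r = 0, 1, 2, …`, on which the wave functions live: the support of
the orthogonality measure, i.e. the nodes of the Jackson integral from `-μ` to `1`. -/
def qGrid (μ q : ℝ) : Set ℝ :=
  {y | ∃ r : ℕ, y = q ^ r ∨ y = -μ * q ^ r}

end AlSalamCarlitz

end

/-!
Write `u_n` for the Al-Salam–Carlitz polynomials and `S_s(t)` for the kernel at `x = q ^ s` without
its weights, `∑ t^n u_n(q^s) u_n(y) / d_n²`. The polynomials satisfy, besides the recurrence in the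
degree, a forward shift relation `x ↦ qx` (`acPoly_mul_left`). Three facts follow from it. First,
on the grid `u_n` grows at most exponentially in `n` (`exists_acPoly_bound`), so that the factor
`q^{n(n-1)/2}` in `d_n⁻²` makes the kernel converge for every `t`. Second, `S_0`, which is the
generating function of `u_n(y)`, is found from Euler's series (`tsum_eulerTerm`) by moving `y` along
the grid: it is formally `(t, -μt; q)_∞ / (ty; q)_∞`. Third, `u_n(x)` satisfies a second-order
`q`-difference equation in `x` with eigenvalue `1 - q⁻ⁿ` (`acPoly_qDifference`). As `q⁻ⁿ` acts on the
series as `t ↦ t / q`, the last fact is a three-term recurrence in `s` which gives `S_{s+1}(t)` in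
terms of `S_s(t)`, `S_{s-1}(t)` and `S_s(t/q)` (`polyKernel_pow_succ`).

The recurrence is solved by
`S_s(t) = ∑_{k ≤ s} [s choose k]_q (t;q)_{s-k} (t/μ)^k h_k(t)`, where `h_0 = S_0` and
`q^{k+1} h_k(t/q) = (q^{k+1} + μt) h_k(t) - t h_{k+1}(t)`. By this relation both sides of the
recurrence are combinations of the `h_k`, and they agree coefficient by coefficient
(`qCoeff_recurrence_zero`, `qCoeff_recurrence_succ`, `eq_sum_qCoeff_of_recurrence`). The relation
holds for `h_k(t) = ∏_{j<k} (q^j - y) · (t, -μt q⁻ᵏ; q)_∞ / (ty q⁻ᵏ; q)_∞`, whose quotient is free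
of denominators when `y` lies on the grid (`exists_basis`). Reversing the finite `q`-shifted
factorials turns the sum into the terminating `₃φ₂` (`polyKernel_pow_eq`).

The case `x = -μ q ^ s` is the case `x = q ^ s` for `μ⁻¹`, `-x/μ`, `-y/μ`, since
`u_n^μ(x) = (-μ)^{-n} u_n^{1/μ}(-x/μ)` (`acPoly_inv`, `polyKernel_inv`).
-/

namespace AlSalamCarlitz

open Filter Topology

/-! ### `q`-shifted factorials -/

section qPochhammer

variable {𝕜 : Type*} [NormedField 𝕜]

@[simp]
lemma qPoch_zero (a q : 𝕜) : qPoch a q 0 = 1 := by simp [qPoch]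

lemma qPoch_succ (a q : 𝕜) (n : ℕ) : qPoch a q (n + 1) = qPoch a q n * (1 - a * q ^ n) := by
  simp [qPoch, Finset.prod_range_succ]

lemma qPoch_succ_left (a q : 𝕜) (n : ℕ) :
    qPoch a q (n + 1) = (1 - a) * qPoch (a * q) q n := by
  simp only [qPoch, Finset.prod_range_succ', pow_zero, mul_one]
  rw [mul_comm]
  congr 1
  exact Finset.prod_congr rfl fun k _ => by ring

lemma qPoch_add (a q : 𝕜) (m n : ℕ) :
    qPoch a q (m + n) = qPoch a q m * qPoch (a * q ^ m) q n := by
  simp only [qPoch, Finset.prod_range_add]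
  congr 1
  exact Finset.prod_congr rfl fun k _ => by ring

/-- Reversing the order of the factors of a finite `q`-shifted factorial. -/
lemma qPoch_mul_inv_pow {a q : 𝕜} (ha : a ≠ 0) (hq : q ≠ 0) (k : ℕ) :
    qPoch (a * (q ^ k)⁻¹) q k * ∏ j ∈ Finset.range k, q ^ (j + 1) =
      qPoch (q * a⁻¹) q k * (-a) ^ k := by
  induction k with
  | zero => simp
  | succ k ih =>
    have h : a * (q ^ (k + 1))⁻¹ * q = a * (q ^ k)⁻¹ := by
      field_simp
      ring
    rw [qPoch_succ_left, h, Finset.prod_range_succ, qPoch_succ, pow_succ (-a)]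
    have h2 : (1 - a * (q ^ (k + 1))⁻¹) * q ^ (k + 1) = (1 - q * a⁻¹ * q ^ k) * -a := by
      field_simp
      ring
    linear_combination ((1 - a * (q ^ (k + 1))⁻¹) * q ^ (k + 1)) * ih +
      (qPoch (q * a⁻¹) q k * (-a) ^ k) * h2

lemma one_sub_pow_ne_zero {q : 𝕜} (hq : ‖q‖ < 1) (n : ℕ) : 1 - q ^ (n + 1) ≠ 0 := fun h => by
  have h2 : ‖q‖ ^ (n + 1) = 1 := by rw [← norm_pow, ← sub_eq_zero.1 h, norm_one]
  exact (pow_lt_one₀ (norm_nonneg q) hq n.succ_ne_zero).ne h2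

lemma qPoch_self_ne_zero {q : 𝕜} (hq : ‖q‖ < 1) (n : ℕ) : qPoch q q n ≠ 0 :=
  Finset.prod_ne_zero_iff.2 fun k _ => by
    rw [← pow_succ']
    exact one_sub_pow_ne_zero hq k

variable [CompleteSpace 𝕜]

lemma tendsto_qPoch {q : 𝕜} (hq : ‖q‖ < 1) (a : 𝕜) :
    Tendsto (qPoch a q) atTop (𝓝 (qPochInf a q)) := by
  have hs : Summable fun k : ℕ => ‖-(a * q ^ k)‖ := by
    simpa using (summable_geometric_of_lt_one (norm_nonneg q) hq).mul_left ‖a‖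
  have hm : Multipliable fun k : ℕ => 1 - a * q ^ k := by
    simpa [sub_eq_add_neg] using multipliable_one_add_of_summable hs
  exact hm.hasProd.tendsto_prod_nat

lemma qPochInf_eq_qPoch_mul {q : 𝕜} (hq : ‖q‖ < 1) (a : 𝕜) (n : ℕ) :
    qPochInf a q = qPoch a q n * qPochInf (a * q ^ n) q := by
  have h1 := (tendsto_qPoch hq a).comp (tendsto_add_atTop_nat n)
  have h2 := (tendsto_qPoch hq (a * q ^ n)).const_mul (qPoch a q n)
  refine tendsto_nhds_unique h1 (h2.congr fun m => ?_)
  simp [← qPoch_add, add_comm]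

lemma qPochInf_nonneg {a q : ℝ} (hq0 : 0 ≤ q) (hq1 : q < 1) (ha : a ≤ 1) :
    0 ≤ qPochInf a q := by
  refine ge_of_tendsto' (tendsto_qPoch (by rwa [Real.norm_of_nonneg hq0]) a) fun n =>
    Finset.prod_nonneg fun k _ => ?_
  have h0 : 0 ≤ q ^ k := pow_nonneg hq0 k
  have h1 : q ^ k ≤ 1 := pow_le_one₀ hq0 hq1.le
  nlinarith

end qPochhammer

/-! ### Euler's series for the infinite product -/

/-- The `n`-th term `q^{n(n-1)/2} z^n / (q;q)_n` of Euler's series for `(-z;q)_∞`. -/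
noncomputable def eulerTerm (q z : ℂ) (n : ℕ) : ℂ :=
  q ^ (n * (n - 1) / 2) * z ^ n / qPoch q q n

@[simp]
lemma eulerTerm_zero (q z : ℂ) : eulerTerm q z 0 = 1 := by simp [eulerTerm]

lemma eulerTerm_succ {q : ℂ} (hq : ‖q‖ < 1) (z : ℂ) (n : ℕ) :
    (1 - q ^ (n + 1)) * eulerTerm q z (n + 1) = z * q ^ n * eulerTerm q z n := by
  have h1 := qPoch_self_ne_zero hq n
  have h2 := qPoch_self_ne_zero hq (n + 1)
  have h3 : (n + 1) * (n + 1 - 1) / 2 = n * (n - 1) / 2 + n := by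
    rw [← Nat.choose_two_right, ← Nat.choose_two_right, Nat.choose_succ_succ' n 1]
    simp [add_comm]
  rw [eulerTerm, eulerTerm, h3]
  rw [qPoch_succ] at h2 ⊢
  have h4 := right_ne_zero_of_mul h2
  have h5 : 1 - q * q ^ n = 1 - q ^ (n + 1) := by ring
  rw [h5] at h4 ⊢
  field_simp
  ring

lemma eulerTerm_mul_pow (q z w : ℂ) (n : ℕ) :
    eulerTerm q (z * w) n = eulerTerm q z n * w ^ n := by
  simp only [eulerTerm, mul_pow]
  ring

lemma summable_norm_eulerTerm {q : ℂ} (hq : ‖q‖ < 1) (z : ℂ) :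
    Summable fun n => ‖eulerTerm q z n‖ := by
  have hstep : ∀ n, eulerTerm q z (n + 1) = z * q ^ n / (1 - q ^ (n + 1)) * eulerTerm q z n := by
    intro n
    rw [div_mul_eq_mul_div, eq_div_iff (one_sub_pow_ne_zero hq n), mul_comm, eulerTerm_succ hq]
  have hlim : Tendsto (fun n : ℕ => ‖z * q ^ n / (1 - q ^ (n + 1))‖) atTop (𝓝 0) := by
    have h0 := tendsto_pow_atTop_nhds_zero_of_norm_lt_one hq
    have h1 : Tendsto (fun n : ℕ => 1 - q ^ (n + 1)) atTop (𝓝 (1 - 0)) :=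
      ((tendsto_add_atTop_iff_nat 1).2 h0).const_sub 1
    have h2 := ((h0.const_mul z).div h1 (by simp)).norm
    rwa [mul_zero, zero_div, norm_zero] at h2
  have hev : ∀ᶠ n : ℕ in atTop, ‖z * q ^ n / (1 - q ^ (n + 1))‖ ≤ 1 / 2 :=
    hlim.eventually_le_const (by norm_num)
  have hsum : Summable (eulerTerm q z) := by
    refine summable_of_ratio_norm_eventually_le (r := 1 / 2) (by norm_num) ?_
    filter_upwards [hev] with n h
    rw [hstep, norm_mul]
    exact mul_le_mul_of_nonneg_right h (norm_nonneg _)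
  exact hsum.norm

/-- Euler's identity: the sum `F(z)` of the series satisfies `F(z) = (1 + z) F(qz)`, and the
product is obtained by iteration since `F` is continuous at `0` with `F(0) = 1`. -/
lemma tsum_eulerTerm {q : ℂ} (hq : ‖q‖ < 1) (z : ℂ) :
    ∑' n, eulerTerm q z n = qPochInf (-z) q := by
  have hs : ∀ w, Summable (eulerTerm q w) := fun w => (summable_norm_eulerTerm hq w).of_norm
  have hfun : ∀ w, ∑' n, eulerTerm q w n = (1 + w) * ∑' n, eulerTerm q (w * q) n := by
    intro w
    have key : ∀ n, eulerTerm q w (n + 1) =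
        eulerTerm q (w * q) (n + 1) + w * eulerTerm q (w * q) n := by
      intro n
      rw [eulerTerm_mul_pow, eulerTerm_mul_pow]
      linear_combination eulerTerm_succ hq w n
    rw [(hs w).tsum_eq_zero_add, tsum_congr key, Summable.tsum_add
      ((summable_nat_add_iff 1).2 (hs (w * q))) ((hs (w * q)).mul_left w), tsum_mul_left]
    have := (hs (w * q)).tsum_eq_zero_add
    simp only [eulerTerm_zero] at this ⊢
    linear_combination -this
  have hiter : ∀ N, ∑' n, eulerTerm q z n =
      qPoch (-z) q N * ∑' n, eulerTerm q (z * q ^ N) n := by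
    intro N
    induction N with
    | zero => simp
    | succ N ih =>
      rw [ih, hfun, qPoch_succ, pow_succ]
      ring_nf
  have hcont : Tendsto (fun N : ℕ => ∑' n, eulerTerm q (z * q ^ N) n) atTop (𝓝 1) := by
    have h1 : (1 : ℂ) = ∑' n, if n = 0 then (1 : ℂ) else 0 := by simp
    rw [h1]
    refine tendsto_tsum_of_dominated_convergence (summable_norm_eulerTerm hq z) ?_ ?_
    · intro n
      rcases n with _ | n
      · simp
      · have h0 := (tendsto_pow_atTop_nhds_zero_of_norm_lt_one hq).pow (n + 1)
        simpa [eulerTerm_mul_pow] using h0.const_mul (eulerTerm q z (n + 1))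
    · refine Eventually.of_forall fun N n => ?_
      rw [eulerTerm_mul_pow, norm_mul, norm_pow, norm_pow]
      exact mul_le_of_le_one_right (norm_nonneg _)
        (pow_le_one₀ (by positivity) (pow_le_one₀ (norm_nonneg q) hq.le))
  have := (tendsto_qPoch hq (-z)).mul hcont
  rw [mul_one] at this
  exact tendsto_nhds_unique (tendsto_const_nhds.congr hiter) this

/-! ### The Al-Salam–Carlitz polynomials -/

section Polynomials

variable {μ q : ℝ}

lemma acPoly_add_two (μ q x : ℝ) (n : ℕ) (hμ : μ ≠ 0) (hq : q ≠ 0) :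
    μ * q ^ (n + 1) * acPoly μ q x (n + 2) = (x - (1 - μ) * q ^ (n + 1)) * acPoly μ q x (n + 1)
      - (1 - q ^ (n + 1)) * acPoly μ q x n := by
  rw [acPoly]
  field_simp

/-- The forward shift in `x`, which expresses that the generating function
`(w, -μw; q)_∞ / (xw; q)_∞` is multiplied by `1 - xw` when `x` is replaced by `qx`. -/
lemma acPoly_mul_left (hμ : μ ≠ 0) (hq : q ≠ 0) (x : ℝ) (n : ℕ) :
    μ * q ^ n * acPoly μ q (q * x) (n + 1) =
      μ * q ^ n * acPoly μ q x (n + 1) - x * (1 - q ^ (n + 1)) * acPoly μ q x n := by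
  induction n using Nat.twoStepInduction with
  | zero =>
    simp only [acPoly]
    field_simp
    ring
  | one =>
    simp only [acPoly]
    field_simp
    ring
  | more n h1 h2 =>
    have e1 := acPoly_add_two μ q x n hμ hq
    have e2 := acPoly_add_two μ q x (n + 1) hμ hq
    have e3 := acPoly_add_two μ q (q * x) (n + 1) hμ hq
    have hQ : q ^ n ≠ 0 := pow_ne_zero n hq
    simp only [pow_succ, Nat.add_assoc, Nat.reduceAdd] at *
    generalize acPoly μ q x n = a0 at *
    generalize acPoly μ q x (n + 1) = a1 at *
    generalize acPoly μ q x (n + 2) = a2 at *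
    generalize acPoly μ q x (n + 3) = a3 at *
    generalize acPoly μ q (q * x) (n + 1) = b1 at *
    generalize acPoly μ q (q * x) (n + 2) = b2 at *
    generalize acPoly μ q (q * x) (n + 3) = b3 at *
    generalize q ^ n = Q at *
    apply mul_left_cancel₀ (mul_ne_zero hμ hQ)
    linear_combination μ * Q * e3 - μ * Q * e2 + (x - (1 - μ) * (Q * q)) * h2 -
      (1 - Q * q * q) * h1 + x * (1 - Q * q * q) * e1

lemma acPoly_one (hμ : μ ≠ 0) (hq : q ≠ 0) (n : ℕ) : acPoly μ q 1 n = 1 := by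
  induction n using Nat.twoStepInduction with
  | zero => simp [acPoly]
  | one => simp [acPoly, hμ]
  | more n h1 h2 =>
    have := acPoly_add_two μ q 1 n hμ hq
    rw [h1, h2] at this
    have h3 : μ * q ^ (n + 1) ≠ 0 := by positivity
    apply mul_left_cancel₀ h3
    linear_combination this

/-- Interchanging the two branches of the grid. -/
lemma acPoly_inv (hμ : μ ≠ 0) (hq : q ≠ 0) (x : ℝ) (n : ℕ) :
    acPoly μ q x n = (-μ⁻¹) ^ n * acPoly μ⁻¹ q (-(μ⁻¹ * x)) n := by
  induction n using Nat.twoStepInduction with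
  | zero => simp [acPoly]
  | one =>
    simp only [acPoly]
    field_simp
    ring
  | more n h1 h2 =>
    have e1 := acPoly_add_two μ q x n hμ hq
    have e2 := acPoly_add_two μ⁻¹ q (-(μ⁻¹ * x)) n (inv_ne_zero hμ) hq
    rw [h1, h2] at e1
    have h3 : μ * q ^ (n + 1) ≠ 0 := by positivity
    apply mul_left_cancel₀ h3
    rw [e1]
    have hm : μ * μ⁻¹ = 1 := mul_inv_cancel₀ hμ
    linear_combination -(-μ⁻¹) ^ n * e2 - ((-μ⁻¹) ^ n * q ^ (n + 1)) *
      (acPoly μ⁻¹ q (-(μ⁻¹ * x)) (n + 1) + μ⁻¹ * acPoly μ⁻¹ q (-(μ⁻¹ * x)) (n + 2)) * hm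

/-- The second-order `q`-difference equation in `x`, with eigenvalue `1 - q⁻ⁿ`; in terms of
`z = x / q` all arguments are non-negative powers of `q` times `z`. -/
lemma acPoly_qDifference (hμ : μ ≠ 0) (hq : q ≠ 0) (z : ℝ) (n : ℕ) :
    q ^ n * (μ * acPoly μ q (q * (q * z)) n
        - (μ + q * (1 - q * z) * (μ + q * z)) * acPoly μ q (q * z) n
        + q * (1 - q * z) * (μ + q * z) * acPoly μ q z n) =
      q * (q * z) ^ 2 * (q ^ n - 1) * acPoly μ q (q * z) n := by
  rcases n with _ | _ | n
  · simp only [acPoly]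
    ring
  · simp only [acPoly]
    field_simp
    ring
  · have A1 := acPoly_mul_left hμ hq z (n + 1)
    have A2 := acPoly_mul_left hμ hq (q * z) (n + 1)
    have A3 := acPoly_mul_left hμ hq z n
    have R := acPoly_add_two μ q z n hμ hq
    have hQ : q ^ n ≠ 0 := pow_ne_zero n hq
    apply mul_left_cancel₀ (mul_ne_zero hμ hQ)
    simp only [pow_succ, Nat.add_assoc, Nat.reduceAdd] at *
    generalize q ^ n = Q at *
    linear_combination q * μ * Q * A2 - q ^ 2 * (1 - q * z) * (μ + q * z) * Q * A1
      + z * q ^ 2 * (1 - q ^ 2 * Q) * (z * A1 + z * R - A3)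

lemma acPoly_neg (hμ : μ ≠ 0) (hq : q ≠ 0) (n : ℕ) : acPoly μ q (-μ) n = (-μ⁻¹) ^ n := by
  rw [acPoly_inv hμ hq, mul_neg, neg_neg, inv_mul_cancel₀ hμ, acPoly_one (inv_ne_zero hμ) hq,
    mul_one]

lemma exists_acPoly_mul_left_bound (hμ : 0 < μ) (hq0 : 0 < q) (hq1 : q < 1) {x : ℝ}
    (h : ∃ C K : ℝ, 1 ≤ K ∧ ∀ n, |acPoly μ q x n| ≤ C * K ^ n) :
    ∃ C K : ℝ, 1 ≤ K ∧ ∀ n, |acPoly μ q (q * x) n| ≤ C * K ^ n := by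
  obtain ⟨C, K, hK, hC⟩ := h
  have hC1 : 1 ≤ C := by simpa [acPoly] using hC 0
  have hKq : K ≤ K / q := by rw [le_div_iff₀ hq0]; nlinarith
  have hx : 0 ≤ |x| / μ := by positivity
  refine ⟨C * (1 + |x| / μ), K / q, hK.trans hKq, fun n => ?_⟩
  rcases n with _ | n
  · simp only [acPoly, pow_zero, mul_one, abs_one]
    nlinarith
  · have hn : q ^ n ≠ 0 := (pow_pos hq0 n).ne'
    have e : acPoly μ q (q * x) (n + 1) =
        acPoly μ q x (n + 1) - x / μ * ((1 - q ^ (n + 1)) / q ^ n) * acPoly μ q x n := by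
      have := acPoly_mul_left hμ.ne' hq0.ne' x n
      field_simp
      linear_combination this
    have hp : 0 < q ^ (n + 1) := pow_pos hq0 _
    have hp1 : q ^ (n + 1) ≤ 1 := pow_le_one₀ hq0.le hq1.le
    have h1 : |(1 - q ^ (n + 1)) / q ^ n| ≤ 1 / q ^ n := by
      rw [abs_div, abs_of_pos (pow_pos hq0 n), abs_of_nonneg (by linarith)]
      gcongr
      linarith
    have h2 : K ^ (n + 1) ≤ (K / q) ^ (n + 1) := by gcongr
    have h3 : 1 / q ^ n * K ^ n ≤ (K / q) ^ (n + 1) := by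
      have : 1 / q ^ n * K ^ n = (K / q) ^ n := by rw [div_pow]; ring
      rw [this]
      exact pow_le_pow_right₀ (hK.trans hKq) n.le_succ
    calc |acPoly μ q (q * x) (n + 1)|
        ≤ |acPoly μ q x (n + 1)|
          + |x| / μ * |(1 - q ^ (n + 1)) / q ^ n| * |acPoly μ q x n| := by
          rw [e]
          refine (abs_sub _ _).trans_eq ?_
          rw [abs_mul, abs_mul, abs_div x, abs_of_pos hμ]
      _ ≤ C * K ^ (n + 1) + |x| / μ * (1 / q ^ n) * (C * K ^ n) := by
          gcongr
          · exact hC _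
          · exact hC _
      _ = C * (K ^ (n + 1) + |x| / μ * (1 / q ^ n * K ^ n)) := by ring
      _ ≤ C * ((K / q) ^ (n + 1) + |x| / μ * (K / q) ^ (n + 1)) := by gcongr
      _ = C * (1 + |x| / μ) * (K / q) ^ (n + 1) := by ring

/-- On the grid the polynomials grow at most exponentially in the degree, although for general
`x` they grow like `q^{-n(n-1)/2}`. -/
lemma exists_acPoly_bound (hμ : 0 < μ) (hq0 : 0 < q) (hq1 : q < 1) {x : ℝ}
    (hx : x ∈ qGrid μ q) : ∃ C K : ℝ, 1 ≤ K ∧ ∀ n, |acPoly μ q x n| ≤ C * K ^ n := by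
  obtain ⟨r, hr⟩ := hx
  induction r generalizing x with
  | zero =>
    rcases hr with rfl | rfl
    · exact ⟨1, 1, le_rfl, fun n => by simp [acPoly_one hμ.ne' hq0.ne']⟩
    · refine ⟨1, max 1 μ⁻¹, le_max_left _ _, fun n => ?_⟩
      rw [pow_zero, mul_one, acPoly_neg hμ.ne' hq0.ne', abs_pow, abs_neg,
        abs_of_pos (inv_pos.2 hμ), one_mul]
      gcongr
      exact le_max_right _ _
  | succ r ih =>
    rcases hr with rfl | rfl
    · rw [pow_succ']
      exact exists_acPoly_mul_left_bound hμ hq0 hq1 (ih (Or.inl rfl))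
    · have : -μ * q ^ (r + 1) = q * (-μ * q ^ r) := by ring
      rw [this]
      exact exists_acPoly_mul_left_bound hμ hq0 hq1 (ih (Or.inr rfl))

lemma pow_mem_qGrid (μ q : ℝ) (r : ℕ) : q ^ r ∈ qGrid μ q := ⟨r, Or.inl rfl⟩

lemma neg_mul_pow_mem_qGrid (μ q : ℝ) (r : ℕ) : -μ * q ^ r ∈ qGrid μ q := ⟨r, Or.inr rfl⟩

end Polynomials

/-! ### The unnormalized kernel -/

/-- The `n`-th term of the kernel without its weights: as `(μt)^n q^{n(n-1)/2} / (q;q)_n` is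
`t^n / d_n²`, it is `t^n u_n(x) u_n(y) / d_n²`. -/
noncomputable def polyTerm (μ q : ℝ) (t : ℂ) (x y : ℝ) (n : ℕ) : ℂ :=
  eulerTerm q (μ * t) n * (acPoly μ q x n : ℂ) * (acPoly μ q y n : ℂ)

/-- The kernel without its weights, `∑ t^n u_n(x) u_n(y) / d_n²`. -/
noncomputable def polyKernel (μ q : ℝ) (t : ℂ) (x y : ℝ) : ℂ :=
  ∑' n, polyTerm μ q t x y n

section Kernel

variable {μ q : ℝ}

lemma norm_ofReal_lt_one (hq0 : 0 < q) (hq1 : q < 1) : ‖(q : ℂ)‖ < 1 := by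
  rwa [Complex.norm_real, Real.norm_of_nonneg hq0.le]

lemma summable_polyTerm (hμ : 0 < μ) (hq0 : 0 < q) (hq1 : q < 1) (t : ℂ) {x y : ℝ}
    (hx : x ∈ qGrid μ q) (hy : y ∈ qGrid μ q) : Summable (polyTerm μ q t x y) := by
  obtain ⟨C, K, hK, hC⟩ := exists_acPoly_bound hμ hq0 hq1 hx
  obtain ⟨D, L, hL, hD⟩ := exists_acPoly_bound hμ hq0 hq1 hy
  have hs := (summable_norm_eulerTerm (norm_ofReal_lt_one hq0 hq1)
    (μ * t * ((K * L : ℝ) : ℂ))).mul_right (C * D)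
  refine Summable.of_norm_bounded hs fun n => ?_
  rw [polyTerm, eulerTerm_mul_pow q (μ * t), norm_mul, norm_mul, norm_mul, norm_pow, Complex.norm_real,
    Complex.norm_real, Complex.norm_real, Real.norm_of_nonneg (show 0 ≤ K * L by positivity),
    Real.norm_eq_abs, Real.norm_eq_abs]
  have h0 : 0 ≤ C * K ^ n := (abs_nonneg _).trans (hC n)
  calc _ ≤ ‖eulerTerm q (μ * t) n‖ * (C * K ^ n) * (D * L ^ n) := by
        gcongr
        · exact hC n
        · exact hD n
    _ = _ := by ring

/-- The kernel with one argument equal to `1` is the generating function of the polynomials, and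
so acquires a factor `1 - ty` when `y` is replaced by `qy`. -/
lemma polyKernel_one_mul_left (hμ : 0 < μ) (hq0 : 0 < q) (hq1 : q < 1) (t : ℂ) {y : ℝ}
    (hy : y ∈ qGrid μ q) (hqy : q * y ∈ qGrid μ q) :
    polyKernel μ q t 1 (q * y) = (1 - t * y) * polyKernel μ q t 1 y := by
  have h1 : (1 : ℝ) ∈ qGrid μ q := by simpa using pow_mem_qGrid μ q 0
  have hs := summable_polyTerm hμ hq0 hq1 t h1 hy
  have key : ∀ n, polyTerm μ q t 1 (q * y) (n + 1) =
      polyTerm μ q t 1 y (n + 1) - t * y * polyTerm μ q t 1 y n := by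
    intro n
    have e := congrArg (Complex.ofReal) (acPoly_mul_left hμ.ne' hq0.ne' y n)
    have e2 := eulerTerm_succ (norm_ofReal_lt_one hq0 hq1) (μ * t) n
    have hn : (μ : ℂ) * (q : ℂ) ^ n ≠ 0 := by
      exact_mod_cast mul_ne_zero hμ.ne' (pow_pos hq0 n).ne'
    simp only [polyTerm, acPoly_one hμ.ne' hq0.ne']
    push_cast at e ⊢
    apply mul_left_cancel₀ hn
    linear_combination eulerTerm q (μ * t) (n + 1) * e - y * (acPoly μ q y n : ℂ) * e2
  have h0 : polyTerm μ q t 1 (q * y) 0 = polyTerm μ q t 1 y 0 := by simp [polyTerm, acPoly]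
  rw [polyKernel, polyKernel, (summable_polyTerm hμ hq0 hq1 t h1 hqy).tsum_eq_zero_add,
    tsum_congr key, Summable.tsum_sub ((summable_nat_add_iff 1).2 hs) (hs.mul_left _),
    tsum_mul_left, h0]
  have := hs.tsum_eq_zero_add
  linear_combination -this

lemma polyKernel_one_pow (hμ : 0 < μ) (hq0 : 0 < q) (hq1 : q < 1) (t : ℂ) (r : ℕ) :
    polyKernel μ q t 1 (q ^ r) = qPoch t (q : ℂ) r * qPochInf (-(μ * t)) (q : ℂ) := by
  induction r with
  | zero =>
    rw [polyKernel, qPoch_zero, one_mul, ← tsum_eulerTerm (norm_ofReal_lt_one hq0 hq1)]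
    simp [polyTerm, acPoly_one hμ.ne' hq0.ne']
  | succ r ih =>
    have h := pow_mem_qGrid μ q (r + 1)
    rw [pow_succ'] at h ⊢
    rw [polyKernel_one_mul_left hμ hq0 hq1 t (pow_mem_qGrid μ q r) h, ih, qPoch_succ]
    push_cast
    ring

lemma polyKernel_one_neg_mul_pow (hμ : 0 < μ) (hq0 : 0 < q) (hq1 : q < 1) (t : ℂ) (r : ℕ) :
    polyKernel μ q t 1 (-μ * q ^ r) = qPoch (-(μ * t)) (q : ℂ) r * qPochInf t (q : ℂ) := by
  induction r with
  | zero =>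
    have h : ∀ n, polyTerm μ q t 1 (-μ * q ^ 0) n = eulerTerm q (-t) n := by
      intro n
      have hm : (μ : ℂ) ≠ 0 := by exact_mod_cast hμ.ne'
      have e : (-t : ℂ) = μ * t * ((-μ⁻¹ : ℝ) : ℂ) := by
        push_cast
        field_simp
      rw [e, eulerTerm_mul_pow, polyTerm, acPoly_one hμ.ne' hq0.ne', pow_zero, mul_one,
        acPoly_neg hμ.ne' hq0.ne']
      push_cast
      ring
    rw [polyKernel, tsum_congr h, tsum_eulerTerm (norm_ofReal_lt_one hq0 hq1), neg_neg,
      qPoch_zero, one_mul]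
  | succ r ih =>
    have h := neg_mul_pow_mem_qGrid μ q (r + 1)
    have e : -μ * q ^ (r + 1) = q * (-μ * q ^ r) := by ring
    rw [e] at h ⊢
    rw [polyKernel_one_mul_left hμ hq0 hq1 t (neg_mul_pow_mem_qGrid μ q r) h, ih, qPoch_succ]
    push_cast
    ring

/-- The recurrence in `s` of the kernel at `x = q ^ s`. For `s = 0` the last coefficient is
zero, so that the truncated difference `s - 1` is harmless. -/
lemma polyKernel_pow_succ (hμ : 0 < μ) (hq0 : 0 < q) (hq1 : q < 1) (t : ℂ) {y : ℝ}
    (hy : y ∈ qGrid μ q) (s : ℕ) :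
    μ * polyKernel μ q t (q ^ (s + 1)) y =
      (μ + q * (1 - q ^ s) * (μ + q ^ s)) * polyKernel μ q t (q ^ s) y
      - q * (1 - q ^ s) * (μ + q ^ s) * polyKernel μ q t (q ^ (s - 1)) y
      + q ^ (2 * s + 1) * (polyKernel μ q t (q ^ s) y - polyKernel μ q (t / q) (q ^ s) y) := by
  have hS : ∀ (w : ℂ) (j : ℕ), HasSum (polyTerm μ q w (q ^ j) y) (polyKernel μ q w (q ^ j) y) :=
    fun w j => (summable_polyTerm hμ hq0 hq1 w (pow_mem_qGrid μ q j) hy).hasSum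
  have hR := (((hS t s).mul_left (μ + q * (1 - q ^ s) * (μ + q ^ s) : ℂ)).sub
    ((hS t (s - 1)).mul_left (q * (1 - q ^ s) * (μ + q ^ s) : ℂ))).add
    (((hS t s).sub (hS (t / q) s)).mul_left ((q : ℂ) ^ (2 * s + 1)))
  refine ((hS t (s + 1)).mul_left (μ : ℂ)).tsum_eq.symm.trans
    ((tsum_congr fun n => ?_).trans hR.tsum_eq)
  -- the `q`-difference equation at `z = q ^ s / q`
  have hd : q ^ n * (μ * acPoly μ q (q ^ (s + 1)) n
      - (μ + q * (1 - q ^ s) * (μ + q ^ s)) * acPoly μ q (q ^ s) n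
      + q * (1 - q ^ s) * (μ + q ^ s) * acPoly μ q (q ^ (s - 1)) n) =
      q * (q ^ s) ^ 2 * (q ^ n - 1) * acPoly μ q (q ^ s) n := by
    rcases s with _ | s
    · have := acPoly_qDifference hμ.ne' hq0.ne' q⁻¹ n
      rw [mul_inv_cancel₀ hq0.ne', mul_one] at this
      simp only [zero_add, pow_one, pow_zero, Nat.zero_sub]
      linear_combination this
    · have := acPoly_qDifference hμ.ne' hq0.ne' (q ^ s) n
      rwa [← pow_succ', ← pow_succ'] at this
  have hd' := congrArg Complex.ofReal hd
  have hn : (q : ℂ) ^ n ≠ 0 := by exact_mod_cast (pow_pos hq0 n).ne'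
  have he : eulerTerm q (μ * (t / q)) n * (q : ℂ) ^ n = eulerTerm q (μ * t) n := by
    rw [← eulerTerm_mul_pow]
    congr 1
    have : (q : ℂ) ≠ 0 := by exact_mod_cast hq0.ne'
    field_simp
  push_cast at hd'
  simp only [polyTerm, ← he]
  apply mul_left_cancel₀ hn
  linear_combination eulerTerm q (μ * (t / q)) n * (acPoly μ q y n : ℂ) * (q : ℂ) ^ n * hd'

end Kernel

/-! ### Solving the recurrence in `s` -/

/-- The coefficient `[s choose k]_q (t;q)_{s-k}`, which is zero for `k > s`. -/
noncomputable def qCoeff (q t : ℂ) (s k : ℕ) : ℂ :=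
  if k ≤ s then qPoch q q s * qPoch t q (s - k) / (qPoch q q (s - k) * qPoch q q k) else 0

lemma qCoeff_add (q t : ℂ) (k j : ℕ) :
    qCoeff q t (k + j) k = qPoch q q (k + j) * qPoch t q j / (qPoch q q j * qPoch q q k) := by
  simp [qCoeff]

lemma qCoeff_of_lt (q t : ℂ) {s k : ℕ} (h : s < k) : qCoeff q t s k = 0 :=
  if_neg (not_le.2 h)

lemma qCoeff_self {q : ℂ} (hq : ‖q‖ < 1) (t : ℂ) (k : ℕ) : qCoeff q t k k = 1 := by
  have := qPoch_self_ne_zero hq k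
  simp [qCoeff, this]

lemma qCoeff_zero {q : ℂ} (hq : ‖q‖ < 1) (t : ℂ) (s : ℕ) : qCoeff q t s 0 = qPoch t q s := by
  have := qPoch_self_ne_zero hq s
  simp [qCoeff, this]

lemma qPoch_div_succ {q : ℂ} (hq0 : q ≠ 0) (t : ℂ) (n : ℕ) :
    qPoch (t / q) q (n + 1) = (1 - t / q) * qPoch t q n := by
  rw [qPoch_succ_left, div_mul_cancel₀ _ hq0]

/-- The coefficient of the zeroth basis function in the recurrence in `s`. -/
lemma qCoeff_recurrence_zero {q : ℂ} (hq0 : q ≠ 0) (hq : ‖q‖ < 1) (μ t : ℂ) (s : ℕ) :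
    μ * qCoeff q t (s + 1) 0 =
      (μ + q * (1 - q ^ s) * (μ + q ^ s)) * qCoeff q t s 0
      - q * (1 - q ^ s) * (μ + q ^ s) * qCoeff q t (s - 1) 0
      + q ^ (2 * s + 1) * (qCoeff q t s 0 - (1 + μ * t / q) * qCoeff q (t / q) s 0) := by
  simp only [qCoeff_zero hq]
  rcases s with _ | s
  · simp only [qPoch_succ, qPoch_zero]
    field_simp
    ring
  · rw [Nat.add_sub_cancel, qPoch_div_succ hq0, qPoch_succ, qPoch_succ]
    field_simp
    ring

/-- The coefficient of the basis function with index `m + 1` in the recurrence in `s`. -/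
lemma qCoeff_recurrence_succ {q : ℂ} (hq0 : q ≠ 0) (hq : ‖q‖ < 1) (μ t : ℂ) (s m : ℕ) :
    μ * qCoeff q t (s + 1) (m + 1) =
      (μ + q * (1 - q ^ s) * (μ + q ^ s)) * qCoeff q t s (m + 1)
      - q * (1 - q ^ s) * (μ + q ^ s) * qCoeff q t (s - 1) (m + 1)
      + q ^ (2 * s + 1) * (qCoeff q t s (m + 1)
        - (q ^ (m + 1))⁻¹ * (1 + μ * t / q ^ (m + 2)) * qCoeff q (t / q) s (m + 1)
        + μ / q ^ (2 * m + 1) * qCoeff q (t / q) s m) := by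
  -- For `s < m` all terms vanish; `s = m` and `s = m + 1` are separate, as some of the coefficients
  -- still vanish there; for `s ≥ m + 2` it is a rational identity in `q ^ m`, `q ^ j` with
  -- `s = m + 2 + j`, after division by common factors.
  rcases lt_trichotomy s m with h | rfl | h
  · simp [qCoeff_of_lt _ _ (show s + 1 < m + 1 by omega), qCoeff_of_lt _ _ h,
      qCoeff_of_lt _ _ (show s < m + 1 by omega),
      qCoeff_of_lt _ _ (show s - 1 < m + 1 by omega)]
  · rw [qCoeff_of_lt _ _ (show s < s + 1 by omega), qCoeff_of_lt _ _ (show s < s + 1 by omega),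
      qCoeff_of_lt _ _ (show s - 1 < s + 1 by omega), qCoeff_self hq, qCoeff_self hq]
    field_simp
    ring
  · obtain ⟨j, rfl⟩ : ∃ j, s = m + 1 + j := ⟨s - (m + 1), by omega⟩
    have hm := qPoch_self_ne_zero hq m
    have hM := one_sub_pow_ne_zero hq m
    have hQ : q ^ m ≠ 0 := pow_ne_zero m hq0
    rcases j with _ | j
    · have h1 := one_sub_pow_ne_zero hq 0
      have e1 := qCoeff_add q t (m + 1) 1
      have e2 := qCoeff_add q (t / q) m 1
      have h2 := qPoch_self_ne_zero hq (m + 1)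
      rw [add_zero, Nat.add_sub_cancel, e1, e2, qCoeff_self hq, qCoeff_self hq,
        qCoeff_of_lt _ _ (show m < m + 1 by omega)]
      simp only [qPoch_succ, qPoch_zero, pow_zero, mul_one, one_mul, zero_add, pow_one] at *
      have hM' : 1 - q * q ^ m ≠ 0 := by rwa [← pow_succ']
      simp only [pow_succ, pow_mul'] at *
      field_simp
      ring
    · have hj := qPoch_self_ne_zero hq j
      have h1 := one_sub_pow_ne_zero hq j
      have h2 := one_sub_pow_ne_zero hq (j + 1)
      have e1 := qCoeff_add q t (m + 1) (j + 2)
      have e2 := fun t => qCoeff_add q t (m + 1) (j + 1)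
      have e3 := qCoeff_add q t (m + 1) j
      have e4 := qCoeff_add q (t / q) m (j + 2)
      have i1 : m + 1 + (j + 1) + 1 = m + 1 + (j + 2) := by omega
      have i2 : m + 1 + (j + 1) - 1 = m + 1 + j := by omega
      have i3 : m + 1 + (j + 1) = m + (j + 2) := by omega
      rw [i1, i2, i3, e1, e3, e4, ← i3, e2, e2]
      have k1 : m + 1 + (j + 2) = m + 1 + j + 1 + 1 := by omega
      have k2 : m + 1 + (j + 1) = m + 1 + j + 1 := by omega
      rw [k1, k2, qPoch_div_succ hq0, qPoch_div_succ hq0]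
      simp only [qPoch_succ]
      have g1 : q * q ^ m = q ^ (m + 1) := (pow_succ' q m).symm
      have g2 : q * q ^ j = q ^ (j + 1) := (pow_succ' q j).symm
      have g3 : q * q ^ (j + 1) = q ^ (j + 1 + 1) := (pow_succ' q (j + 1)).symm
      rw [g1, g2, g3]
      have p1 : q ^ (m + 1 + j + 1) = q ^ m * q ^ j * q ^ 2 := by ring
      have p2 : q ^ (m + 1 + j) = q ^ m * q ^ j * q := by ring
      have p3 : q ^ (2 * (m + 1 + j + 1) + 1) = (q ^ m) ^ 2 * (q ^ j) ^ 2 * q ^ 5 := by ring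
      have p4 : q ^ (2 * m + 1) = (q ^ m) ^ 2 * q := by ring
      have p5 : q ^ (m + 2) = q ^ m * q ^ 2 := by ring
      simp only [p1, p2, p3, p4, p5]
      have p6 : q ^ (m + 1) = q ^ m * q := by ring
      have p7 : q ^ (j + 1) = q ^ j * q := by ring
      have p8 : q ^ (j + 1 + 1) = q ^ j * q ^ 2 := by ring
      simp only [p6, p7, p8] at hM h1 h2 ⊢
      generalize qPoch q q (m + 1 + j) = F
      generalize qPoch q q m = f at hm ⊢
      generalize qPoch q q j = g at hj ⊢
      generalize qPoch t q j = T
      generalize q ^ m = M at hM hQ ⊢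
      generalize q ^ j = J at h1 h2 ⊢
      generalize hA : 1 - M * q = A at hM ⊢
      generalize hB : 1 - J * q = B at h1 ⊢
      generalize hC : 1 - J * q ^ 2 = C at h2 ⊢
      field_simp
      rw [← hA, ← hB, ← hC]
      ring

/-- A sequence of functions that satisfies the recurrence in `s` is a combination, with coefficients
`[s choose k]_q (t;q)_{s-k} (t/μ)^k`, of the functions `h k` which arise from its initial value
`h 0` by the first-order relation `hh`. -/
lemma eq_sum_qCoeff_of_recurrence {q μ : ℂ} (hq0 : q ≠ 0) (hq : ‖q‖ < 1) (hμ : μ ≠ 0)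
    (S h : ℕ → ℂ → ℂ) (h0 : ∀ t, S 0 t = h 0 t)
    (hS : ∀ s t, μ * S (s + 1) t = (μ + q * (1 - q ^ s) * (μ + q ^ s)) * S s t
      - q * (1 - q ^ s) * (μ + q ^ s) * S (s - 1) t + q ^ (2 * s + 1) * (S s t - S s (t / q)))
    (hh : ∀ k t, q ^ (k + 1) * h k (t / q) = (q ^ (k + 1) + μ * t) * h k t - t * h (k + 1) t)
    (s : ℕ) (t : ℂ) :
    S s t = ∑ k ∈ Finset.range (s + 1), qCoeff q t s k * ((t / μ) ^ k * h k t) := by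
  induction s using Nat.strong_induction_on generalizing t with
  | _ s ih =>
  rcases s with _ | s
  · simp [h0, qCoeff_self hq]
  · -- the sums may be extended, as the coefficients vanish for `k > s`
    have ext : ∀ n t, n ≤ s → S n t =
        ∑ m ∈ Finset.range (s + 1), qCoeff q t n (m + 1) * ((t / μ) ^ (m + 1) * h (m + 1) t)
          + qCoeff q t n 0 * h 0 t := by
      intro n t hn
      rw [ih n (by omega)]
      have : Finset.range (n + 1) ⊆ Finset.range (s + 2) := by
        intro i hi
        simp only [Finset.mem_range] at *
        omega
      rw [Finset.sum_subset this, Finset.sum_range_succ']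
      · simp
      · intro i _ hi
        rw [qCoeff_of_lt _ _ (by simpa using hi), zero_mul]
    have shift : ∀ k, (t / q / μ) ^ k * h k (t / q) =
        (q ^ k)⁻¹ * (1 + μ * t / q ^ (k + 1)) * ((t / μ) ^ k * h k t)
          - μ / q ^ (2 * k + 1) * ((t / μ) ^ (k + 1) * h (k + 1) t) := by
      intro k
      have e : h k (t / q) = ((q ^ (k + 1) + μ * t) * h k t - t * h (k + 1) t) / q ^ (k + 1) := by
        rw [eq_div_iff (pow_ne_zero _ hq0), ← hh]
        ring
      rw [e]
      have : q ^ (2 * k + 1) = q ^ k * q ^ (k + 1) := by ring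
      rw [this]
      have e3 : t / q / μ = t / μ * q⁻¹ := by field_simp
      rw [e3, mul_pow, pow_succ (t / μ), inv_pow]
      field_simp
    have hshift : S s (t / q) = ∑ m ∈ Finset.range (s + 1),
        (q ^ (m + 1))⁻¹ * (1 + μ * t / q ^ (m + 2)) * qCoeff q (t / q) s (m + 1) *
          ((t / μ) ^ (m + 1) * h (m + 1) t)
        + (1 + μ * t / q) * qCoeff q (t / q) s 0 * h 0 t
        - ∑ m ∈ Finset.range (s + 1), μ / q ^ (2 * m + 1) * qCoeff q (t / q) s m *
          ((t / μ) ^ (m + 1) * h (m + 1) t) := by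
      have e : S s (t / q) = ∑ k ∈ Finset.range (s + 2), qCoeff q (t / q) s k *
            ((q ^ k)⁻¹ * (1 + μ * t / q ^ (k + 1)) * ((t / μ) ^ k * h k t))
          - ∑ k ∈ Finset.range (s + 1), qCoeff q (t / q) s k *
            (μ / q ^ (2 * k + 1) * ((t / μ) ^ (k + 1) * h (k + 1) t)) := by
        rw [ih s (by omega), Finset.sum_range_succ _ (s + 1),
          qCoeff_of_lt _ _ (show s < s + 1 by omega), zero_mul, add_zero]
        simp only [shift, mul_sub, Finset.sum_sub_distrib]
      rw [e, Finset.sum_range_succ']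
      congr 1
      · congr 1
        · exact Finset.sum_congr rfl fun m _ => by ring
        · simp only [pow_zero, inv_one, zero_add, pow_one]
          ring
      · exact Finset.sum_congr rfl fun m _ => by ring
    apply mul_left_cancel₀ hμ
    have key : μ * ∑ m ∈ Finset.range (s + 1),
          qCoeff q t (s + 1) (m + 1) * ((t / μ) ^ (m + 1) * h (m + 1) t) =
        (μ + q * (1 - q ^ s) * (μ + q ^ s)) * ∑ m ∈ Finset.range (s + 1),
          qCoeff q t s (m + 1) * ((t / μ) ^ (m + 1) * h (m + 1) t)
        - q * (1 - q ^ s) * (μ + q ^ s) * ∑ m ∈ Finset.range (s + 1),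
          qCoeff q t (s - 1) (m + 1) * ((t / μ) ^ (m + 1) * h (m + 1) t)
        + q ^ (2 * s + 1) * (∑ m ∈ Finset.range (s + 1),
            qCoeff q t s (m + 1) * ((t / μ) ^ (m + 1) * h (m + 1) t)
          - ∑ m ∈ Finset.range (s + 1),
            (q ^ (m + 1))⁻¹ * (1 + μ * t / q ^ (m + 2)) * qCoeff q (t / q) s (m + 1) *
              ((t / μ) ^ (m + 1) * h (m + 1) t)
          + ∑ m ∈ Finset.range (s + 1), μ / q ^ (2 * m + 1) * qCoeff q (t / q) s m *
              ((t / μ) ^ (m + 1) * h (m + 1) t)) := by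
      simp only [Finset.mul_sum, ← Finset.sum_add_distrib, ← Finset.sum_sub_distrib]
      refine Finset.sum_congr rfl fun m _ => ?_
      linear_combination ((t / μ) ^ (m + 1) * h (m + 1) t) *
        qCoeff_recurrence_succ hq0 hq μ t s m
    rw [hS, hshift, ext s t le_rfl, ext (s - 1) t (Nat.sub_le _ _),
      Finset.sum_range_succ' _ (s + 1)]
    simp only [pow_zero, one_mul]
    linear_combination -key - h 0 t * qCoeff_recurrence_zero hq0 hq μ t s

/-! ### Evaluation of the kernel -/

section Evaluation

variable {μ q : ℝ}

lemma prod_pow_sub_eq {q y : ℂ} (hy : y ≠ 0) (k : ℕ) :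
    ∏ j ∈ Finset.range k, (q ^ j - y) = (-y) ^ k * qPoch y⁻¹ q k := by
  rw [qPoch, ← Finset.card_range k, ← Finset.prod_const, Finset.card_range,
    ← Finset.prod_mul_distrib]
  refine Finset.prod_congr rfl fun j _ => ?_
  field_simp
  ring

/-- The functions into which the kernel expands. Formally
`g k t = (t, -μ t q⁻ᵏ; q)_∞ / (t y q⁻ᵏ; q)_∞`; on either branch of the grid the quotient reduces to
an expression without denominators. The products `∏_{j<k} (q^j - y) g k t` satisfy the first-order
relation of `eq_sum_qCoeff_of_recurrence`; for `y = q ^ r` they vanish for `k > r`, which is why the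
truncated difference `r - k` in the witness does no harm. -/
lemma exists_basis (hμ : 0 < μ) (hq0 : 0 < q) (hq1 : q < 1) {y : ℝ} (hy : y ∈ qGrid μ q) :
    ∃ g : ℕ → ℂ → ℂ, (∀ t, polyKernel μ q t 1 y = g 0 t) ∧
      (∀ (k : ℕ) (t : ℂ), (q : ℂ) ^ (k + 1) *
          ((∏ j ∈ Finset.range k, ((q : ℂ) ^ j - y)) * g k (t / q)) =
        ((q : ℂ) ^ (k + 1) + μ * t) * ((∏ j ∈ Finset.range k, ((q : ℂ) ^ j - y)) * g k t)
          - t * ((∏ j ∈ Finset.range (k + 1), ((q : ℂ) ^ j - y)) * g (k + 1) t)) ∧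
      (∀ (k : ℕ) (t : ℂ), ∏ j ∈ Finset.range k, ((q : ℂ) ^ j - y) ≠ 0 →
        g k t * qPochInf (t * y * ((q : ℂ) ^ k)⁻¹) (q : ℂ) =
          qPochInf t (q : ℂ) * qPochInf (-(μ * t) * ((q : ℂ) ^ k)⁻¹) (q : ℂ)) := by
  have hn := norm_ofReal_lt_one hq0 hq1
  have hq : (q : ℂ) ≠ 0 := by exact_mod_cast hq0.ne'
  have hw : ∀ (k : ℕ) (t : ℂ),
      -(μ * (t / q)) * ((q : ℂ) ^ k)⁻¹ = -(μ * t) * ((q : ℂ) ^ (k + 1))⁻¹ := by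
    intro k t
    field_simp
    ring
  have hwq : ∀ (k : ℕ) (t : ℂ),
      -(μ * t) * ((q : ℂ) ^ (k + 1))⁻¹ * q = -(μ * t) * ((q : ℂ) ^ k)⁻¹ := by
    intro k t
    field_simp
    ring
  have hw1 : ∀ (k : ℕ) (t : ℂ), (q : ℂ) ^ (k + 1) + μ * t =
      (q : ℂ) ^ (k + 1) * (1 - -(μ * t) * ((q : ℂ) ^ (k + 1))⁻¹) := by
    intro k t
    field_simp
    ring
  obtain ⟨r, rfl | rfl⟩ := hy
  · have hzero : ∀ k, r < k →
        ∏ j ∈ Finset.range k, ((q : ℂ) ^ j - ((q ^ r : ℝ) : ℂ)) = 0 := fun k hk =>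
      Finset.prod_eq_zero (Finset.mem_range.2 hk) (by simp)
    refine ⟨fun k t => qPoch t (q : ℂ) (r - k) * qPochInf (-(μ * t) * ((q : ℂ) ^ k)⁻¹) (q : ℂ),
      ?_, ?_, ?_⟩
    · intro t
      simp [polyKernel_one_pow hμ hq0 hq1]
    · intro k t
      have hinf := qPochInf_eq_qPoch_mul hn (-(μ * t) * ((q : ℂ) ^ (k + 1))⁻¹) 1
      rw [pow_one, hwq, qPoch_succ, qPoch_zero, one_mul, pow_zero, mul_one] at hinf
      rcases lt_trichotomy k r with h | rfl | h
      · obtain ⟨j, rfl⟩ : ∃ j, r = k + 1 + j := ⟨r - (k + 1), by omega⟩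
        have i1 : k + 1 + j - k = j + 1 := by omega
        have i2 : k + 1 + j - (k + 1) = j := by omega
        rw [Finset.prod_range_succ]
        simp only [i1, i2, hw, hw1]
        rw [qPoch_div_succ hq, qPoch_succ, hinf]
        push_cast
        have : (q : ℂ) ^ (k + 1 + j) = (q : ℂ) ^ k * q * (q : ℂ) ^ j := by ring
        rw [this, pow_succ]
        generalize ∏ j_1 ∈ Finset.range k, ((q : ℂ) ^ j_1 - (q : ℂ) ^ k * q * (q : ℂ) ^ j) = E
        field_simp
        ring
      · rw [hzero (k + 1) k.lt_succ_self]
        simp only [Nat.sub_self, qPoch_zero, hw, hw1, hinf]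
        ring
      · rw [hzero k h, hzero (k + 1) (by omega)]
        ring
    · intro k t hk
      have hkr : k ≤ r := not_lt.1 fun h => hk (hzero k h)
      have e : t * ((q ^ r : ℝ) : ℂ) * ((q : ℂ) ^ k)⁻¹ = t * (q : ℂ) ^ (r - k) := by
        rw [pow_sub₀ _ hq hkr]
        push_cast
        ring
      rw [e, qPochInf_eq_qPoch_mul hn t (r - k)]
      ring
  · refine ⟨fun k t => qPoch (-(μ * t) * ((q : ℂ) ^ k)⁻¹) (q : ℂ) r * qPochInf t (q : ℂ),
      ?_, ?_, ?_⟩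
    · intro t
      simp only [polyKernel_one_neg_mul_pow hμ hq0 hq1, pow_zero, inv_one, mul_one]
    · intro k t
      have hfin := qPoch_succ_left (-(μ * t) * ((q : ℂ) ^ (k + 1))⁻¹) (q : ℂ) r
      have hinf := qPochInf_eq_qPoch_mul hn (t / q) 1
      rw [pow_one, div_mul_cancel₀ _ hq, qPoch_succ, qPoch_zero, one_mul, pow_zero,
        mul_one] at hinf
      rw [hwq, qPoch_succ] at hfin
      rw [Finset.prod_range_succ]
      simp only [hw, hw1, hinf]
      push_cast
      generalize ∏ j ∈ Finset.range k, ((q : ℂ) ^ j - -(μ : ℂ) * (q : ℂ) ^ r) = E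
      have e : ∀ a b c d : ℂ, a * b = c * d → (q : ℂ) ^ (k + 1) * c * (E * (d * qPochInf t (q : ℂ)))
        = (q : ℂ) ^ (k + 1) * E * (a * b) * qPochInf t (q : ℂ) := by
        intro a b c d h
        rw [h]
        ring
      rw [e _ _ _ _ hfin, pow_succ]
      field_simp
      ring
    · intro k t _
      have e : t * ((-μ * q ^ r : ℝ) : ℂ) * ((q : ℂ) ^ k)⁻¹ =
          -(μ * t) * ((q : ℂ) ^ k)⁻¹ * (q : ℂ) ^ r := by
        push_cast
        ring
      rw [e, qPochInf_eq_qPoch_mul hn (-(μ * t) * ((q : ℂ) ^ k)⁻¹) r]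
      ring

lemma qPoch_inv_pow_eq_zero {q : ℂ} (hq : q ≠ 0) {s k : ℕ} (h : s < k) :
    qPoch (q ^ s)⁻¹ q k = 0 :=
  Finset.prod_eq_zero (Finset.mem_range.2 h) (by simp [hq])

/-- The value of the unnormalized kernel for `x = q ^ s`. -/
lemma polyKernel_pow_eq (hμ : 0 < μ) (hq0 : 0 < q) (hq1 : q < 1) {t : ℂ} (ht : t ≠ 0) (s : ℕ)
    {x y : ℝ} (hx : x = q ^ s) (hy : y ∈ qGrid μ q)
    (htx : qPochInf (t * x) (q : ℂ) ≠ 0) (hty : qPochInf (t * y) (q : ℂ) ≠ 0)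
    (hden : ∀ k : ℕ, qPoch (x : ℂ)⁻¹ (q : ℂ) k * qPoch (y : ℂ)⁻¹ (q : ℂ) k ≠ 0 →
      qPoch (q * (t * x)⁻¹) (q : ℂ) k * qPoch (q * (t * y)⁻¹) (q : ℂ) k ≠ 0) :
    polyKernel μ q t x y =
      (qPochInf t (q : ℂ) * qPochInf t (q : ℂ) * qPochInf (-(μ * t)) (q : ℂ) /
        (qPochInf (t * x) (q : ℂ) * qPochInf (t * y) (q : ℂ))) *
      phi32 (x : ℂ)⁻¹ (y : ℂ)⁻¹ (-(q * (μ * t)⁻¹)) (q * (t * x)⁻¹) (q * (t * y)⁻¹) q q := by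
  have hn := norm_ofReal_lt_one hq0 hq1
  have hq : (q : ℂ) ≠ 0 := by exact_mod_cast hq0.ne'
  have hm : (μ : ℂ) ≠ 0 := by exact_mod_cast hμ.ne'
  have hy0 : (y : ℂ) ≠ 0 := by
    obtain ⟨r, rfl | rfl⟩ := hy
    · exact_mod_cast (pow_pos hq0 r).ne'
    · exact_mod_cast mul_ne_zero (neg_ne_zero.2 hμ.ne') (pow_pos hq0 r).ne'
  obtain ⟨g, hg0, hg1, hg2⟩ := exists_basis hμ hq0 hq1 hy
  have hsum := eq_sum_qCoeff_of_recurrence hq hn hm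
    (fun s t => polyKernel μ q t (q ^ s) y)
    (fun k t => (∏ j ∈ Finset.range k, ((q : ℂ) ^ j - y)) * g k t)
    (fun t => by simpa using hg0 t) (fun s t => polyKernel_pow_succ hμ hq0 hq1 t hy s) hg1 s t
  have hxc : (x : ℂ) = (q : ℂ) ^ s := by rw [hx]; push_cast; rfl
  rw [hx]
  beta_reduce at hsum
  rw [hsum, ← hx]
  rw [hxc] at htx hden ⊢
  rw [phi32, tsum_eq_sum (s := Finset.range (s + 1)) (fun k hk => by
    rw [qPoch_inv_pow_eq_zero hq (by simpa using hk)]; simp), Finset.mul_sum]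
  refine Finset.sum_congr rfl fun k hk => ?_
  obtain ⟨j, rfl⟩ : ∃ j, s = k + j := ⟨s - k, by rw [Finset.mem_range] at hk; omega⟩
  rw [qCoeff_add, prod_pow_sub_eq hy0]
  specialize hden k
  by_cases hb : qPoch (y : ℂ)⁻¹ (q : ℂ) k = 0
  · simp [hb]
  -- Reversed factorials; the powers of `q` in `P` cancel in the end.
  set P := ∏ j ∈ Finset.range k, (q : ℂ) ^ (j + 1) with hP
  have hP0 : P ≠ 0 := Finset.prod_ne_zero_iff.2 fun j _ => pow_ne_zero _ hq
  have hmt : -((μ : ℂ) * t) ≠ 0 := neg_ne_zero.2 (mul_ne_zero hm ht)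
  have hty0 : t * (y : ℂ) ≠ 0 := mul_ne_zero ht hy0
  have htx0 : t * (q : ℂ) ^ (k + j) ≠ 0 := mul_ne_zero ht (pow_ne_zero _ hq)
  have r1 := qPoch_mul_inv_pow (pow_ne_zero (k + j + 1) hq) hq k
  have r2 := qPoch_mul_inv_pow htx0 hq k
  have r3 := qPoch_mul_inv_pow hmt hq k
  have r4 := qPoch_mul_inv_pow hty0 hq k
  rw [← hP] at r1 r2 r3 r4
  have e1 : (q : ℂ) ^ (k + j + 1) * ((q : ℂ) ^ k)⁻¹ = q * (q : ℂ) ^ j := by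
    field_simp
    ring
  have e1' : (q : ℂ) * ((q : ℂ) ^ (k + j + 1))⁻¹ = ((q : ℂ) ^ (k + j))⁻¹ := by
    field_simp
    ring
  have e2 : t * (q : ℂ) ^ (k + j) * ((q : ℂ) ^ k)⁻¹ = t * (q : ℂ) ^ j := by
    field_simp
    ring
  have e3 : (q : ℂ) * (-(μ * t))⁻¹ = -(q * (μ * t)⁻¹) := by rw [inv_neg, mul_neg]
  rw [e1, e1'] at r1
  rw [e2] at r2
  rw [e3, neg_neg] at r3
  have s1 := qPoch_add (q : ℂ) (q : ℂ) j k
  have s2 := qPoch_add t (q : ℂ) j k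
  have s3 := qPochInf_eq_qPoch_mul hn (-(μ * t) * ((q : ℂ) ^ k)⁻¹) k
  have s4 := qPochInf_eq_qPoch_mul hn (t * y * ((q : ℂ) ^ k)⁻¹) k
  have s5 := qPochInf_eq_qPoch_mul hn t (k + j)
  rw [inv_mul_cancel_right₀ (pow_ne_zero k hq)] at s3 s4
  rw [add_comm j k] at s1 s2
  have hqs := qPoch_self_ne_zero hn (k + j)
  have hqj := qPoch_self_ne_zero hn j
  have hqk := qPoch_self_ne_zero hn k
  have hA1 : qPoch ((q : ℂ) * (q : ℂ) ^ j) (q : ℂ) k ≠ 0 := by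
    rw [s1] at hqs
    exact right_ne_zero_of_mul hqs
  have ha : qPoch ((q : ℂ) ^ (k + j))⁻¹ (q : ℂ) k ≠ 0 := by
    rw [← mul_ne_zero_iff_right (pow_ne_zero k (neg_ne_zero.2 (pow_ne_zero (k + j + 1) hq))), ← r1]
    exact mul_ne_zero hA1 hP0
  have hde := hden (mul_ne_zero ha hb)
  have hd := left_ne_zero_of_mul hde
  have he := right_ne_zero_of_mul hde
  have hgk := hg2 k t (by
    rw [prod_pow_sub_eq hy0]
    exact mul_ne_zero (pow_ne_zero k (neg_ne_zero.2 hy0)) hb)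
  rw [s3, s4] at hgk
  have hpow : (-(t * (q : ℂ) ^ (k + j))) ^ k * (-(t * y)) ^ k * (q : ℂ) ^ k =
      (t / μ) ^ k * (-y) ^ k * ((-(q : ℂ) ^ (k + j + 1)) ^ k * (μ * t) ^ k) := by
    simp only [← mul_pow]
    congr 1
    field_simp
    ring
  have w1 : (-(q : ℂ) ^ (k + j + 1)) ^ k ≠ 0 :=
    pow_ne_zero k (neg_ne_zero.2 (pow_ne_zero (k + j + 1) hq))
  have w2 : (-(t * (q : ℂ) ^ (k + j))) ^ k ≠ 0 := pow_ne_zero k (neg_ne_zero.2 htx0)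
  have w3 : ((μ : ℂ) * t) ^ k ≠ 0 := pow_ne_zero k (mul_ne_zero hm ht)
  have w4 : (-(t * (y : ℂ))) ^ k ≠ 0 := pow_ne_zero k (neg_ne_zero.2 hty0)
  have hA2 : qPoch (t * (q : ℂ) ^ j) (q : ℂ) k ≠ 0 :=
    left_ne_zero_of_mul (r2 ▸ mul_ne_zero hd w2)
  have hA4 : qPoch (t * y * ((q : ℂ) ^ k)⁻¹) (q : ℂ) k ≠ 0 :=
    left_ne_zero_of_mul (r4 ▸ mul_ne_zero he w4)
  rw [(eq_div_iff w1).2 r1.symm, (eq_div_iff w2).2 r2.symm, (eq_div_iff w3).2 r3.symm,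
    (eq_div_iff w4).2 r4.symm, (eq_div_iff (mul_ne_zero hA4 hty)).2 hgk, s5, s2, s1]
  generalize qPoch (t * y * ((q : ℂ) ^ k)⁻¹) (q : ℂ) k = A4 at hA4 ⊢
  generalize qPoch (-(μ * t) * ((q : ℂ) ^ k)⁻¹) (q : ℂ) k = A3
  generalize qPoch (t * (q : ℂ) ^ j) (q : ℂ) k = A2 at hA2 ⊢
  generalize qPoch ((q : ℂ) * (q : ℂ) ^ j) (q : ℂ) k = A1
  generalize qPochInf (t * (q : ℂ) ^ (k + j)) (q : ℂ) = X at htx ⊢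
  generalize qPochInf (t * y) (q : ℂ) = Y at hty ⊢
  generalize qPochInf (-(μ * t)) (q : ℂ) = M
  generalize (-(q : ℂ) ^ (k + j + 1)) ^ k = W1 at hpow w1 ⊢
  generalize (-(t * (q : ℂ) ^ (k + j))) ^ k = W2 at hpow w2 ⊢
  generalize ((μ : ℂ) * t) ^ k = W3 at hpow w3 ⊢
  generalize (-(t * (y : ℂ))) ^ k = W4 at hpow w4 ⊢
  generalize (q : ℂ) ^ k = qk at hpow ⊢
  generalize (t / μ) ^ k = tk at hpow ⊢
  generalize (-(y : ℂ)) ^ k = yk at hpow ⊢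
  generalize qPoch (q : ℂ) (q : ℂ) j = Qj at hqj ⊢
  generalize qPoch (q : ℂ) (q : ℂ) k = Qk at hqk ⊢
  generalize qPoch t (q : ℂ) j = Tj
  generalize qPoch (y : ℂ)⁻¹ (q : ℂ) k = b
  field_simp
  linear_combination -(A1 * Tj ^ 2 * b * A3 * M) * hpow

end Evaluation

/-! ### The normalized kernel -/

section Normalized

variable {μ q : ℝ}

lemma weight_mul_abs_nonneg (hμ : 0 < μ) (hq0 : 0 < q) (hq1 : q < 1) {x : ℝ}
    (hx : x ∈ qGrid μ q) : 0 ≤ weight μ q x * |x| := by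
  have hr : ∀ r : ℕ, 0 < q ^ r ∧ q ^ r ≤ 1 := fun r =>
    ⟨pow_pos hq0 r, pow_le_one₀ hq0.le hq1.le⟩
  have hx' : q * x ≤ 1 ∧ -(μ⁻¹ * q * x) ≤ 1 := by
    obtain ⟨r, rfl | rfl⟩ := hx
    · have : 0 < μ⁻¹ * q * q ^ r := mul_pos (mul_pos (inv_pos.2 hμ) hq0) (hr r).1
      constructor <;> nlinarith [(hr r).1, (hr r).2]
    · have e : -(μ⁻¹ * q * (-μ * q ^ r)) = q * q ^ r := by field_simp
      have : 0 < q * (μ * q ^ r) := mul_pos hq0 (mul_pos hμ (hr r).1)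
      rw [e]
      constructor <;> nlinarith [(hr r).1, (hr r).2]
  have h3 : 0 < q / μ := div_pos hq0 hμ
  have hp : ∀ a : ℝ, a ≤ 1 → 0 ≤ qPochInf a q := fun a => qPochInf_nonneg hq0.le hq1
  exact mul_nonneg (div_nonneg (mul_nonneg (hp _ hx'.1) (hp _ hx'.2))
    (mul_nonneg (mul_nonneg (hp _ hq1.le) (hp _ (by linarith))) (hp _ (by linarith))))
    (abs_nonneg x)

lemma normSq_nonneg (hμ : 0 < μ) (hq0 : 0 < q) (hq1 : q < 1) (n : ℕ) : 0 ≤ normSq μ q n := by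
  have h : 0 ≤ qPoch q q n := Finset.prod_nonneg fun k _ => by
    rw [← pow_succ', sub_nonneg]
    exact pow_le_one₀ hq0.le hq1.le
  unfold normSq
  positivity

lemma pow_div_normSq (μ q : ℝ) (t : ℂ) (n : ℕ) :
    t ^ n * ((normSq μ q n)⁻¹ : ℝ) = eulerTerm q (μ * t) n := by
  simp only [normSq, eulerTerm, qPoch]
  push_cast
  simp only [mul_inv, inv_inv, div_eq_mul_inv, mul_pow]
  ring

lemma kernelTerm_eq (hμ : 0 < μ) (hq0 : 0 < q) (hq1 : q < 1) (t : ℂ) {x y : ℝ}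
    (hx : x ∈ qGrid μ q) (n : ℕ) :
    kernelTerm μ q t x y n =
      ((√(weight μ q x * weight μ q y * |x * y|) : ℝ) : ℂ) * polyTerm μ q t x y n := by
  have h1 : weight μ q x * weight μ q y * |x * y| =
      weight μ q x * |x| * (weight μ q y * |y|) := by
    rw [abs_mul]
    ring
  have h2 : ((√(normSq μ q n))⁻¹ : ℂ) * ((√(normSq μ q n))⁻¹ : ℂ) = ((normSq μ q n)⁻¹ : ℝ) := by
    rw [← mul_inv, ← Complex.ofReal_mul, Real.mul_self_sqrt (normSq_nonneg hμ hq0 hq1 n),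
      Complex.ofReal_inv]
  rw [h1, Real.sqrt_mul (weight_mul_abs_nonneg hμ hq0 hq1 hx), kernelTerm, waveFn, waveFn,
    polyTerm, ← pow_div_normSq, ← h2]
  push_cast
  ring

lemma summable_kernelTerm (hμ : 0 < μ) (hq0 : 0 < q) (hq1 : q < 1) (t : ℂ) {x y : ℝ}
    (hx : x ∈ qGrid μ q) (hy : y ∈ qGrid μ q) : Summable (kernelTerm μ q t x y) := by
  rw [funext (kernelTerm_eq hμ hq0 hq1 t (y := y) hx)]
  exact (summable_polyTerm hμ hq0 hq1 t hx hy).mul_left _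

lemma qKernel_eq (hμ : 0 < μ) (hq0 : 0 < q) (hq1 : q < 1) (t : ℂ) {x y : ℝ}
    (hx : x ∈ qGrid μ q) :
    qKernel μ q t x y =
      ((√(weight μ q x * weight μ q y * |x * y|) : ℝ) : ℂ) * polyKernel μ q t x y := by
  rw [qKernel, funext (kernelTerm_eq hμ hq0 hq1 t (y := y) hx), tsum_mul_left, polyKernel]

lemma polyKernel_inv (hμ : 0 < μ) (hq0 : 0 < q) (t : ℂ) (x y : ℝ) :
    polyKernel μ q t x y = polyKernel μ⁻¹ q t (-(μ⁻¹ * x)) (-(μ⁻¹ * y)) := by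
  refine tsum_congr fun n => ?_
  have hm : (μ : ℂ) ≠ 0 := by exact_mod_cast hμ.ne'
  have e : ((μ⁻¹ : ℝ) : ℂ) * t = μ * t * ((-(μ : ℂ)⁻¹) * (-(μ : ℂ)⁻¹)) := by
    push_cast
    field_simp
  rw [polyTerm, polyTerm, e, eulerTerm_mul_pow q (μ * t), acPoly_inv hμ.ne' hq0.ne' x,
    acPoly_inv hμ.ne' hq0.ne' y, mul_pow]
  push_cast
  ring

lemma neg_inv_mul_mem_qGrid (hμ : μ ≠ 0) {y : ℝ} (hy : y ∈ qGrid μ q) :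
    -(μ⁻¹ * y) ∈ qGrid μ⁻¹ q := by
  obtain ⟨r, rfl | rfl⟩ := hy
  · exact ⟨r, Or.inr (by ring)⟩
  · exact ⟨r, Or.inl (by field_simp)⟩

end Normalized

end AlSalamCarlitz

theorem mainTheorem3 (μ q : ℝ) (hμ : 0 < μ) (hq0 : 0 < q) (hq1 : q < 1)
    (t : ℂ) (ht : t ≠ 0) (s : ℕ) (x y : ℝ) (hy : y ∈ AlSalamCarlitz.qGrid μ q) :
    -- the case `x = q^s`
    (x = q ^ s →
      AlSalamCarlitz.qPochInf (t * x) (q : ℂ) ≠ 0 →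
      AlSalamCarlitz.qPochInf (t * y) (q : ℂ) ≠ 0 →
      (∀ k : ℕ,
        AlSalamCarlitz.qPoch (x : ℂ)⁻¹ (q : ℂ) k * AlSalamCarlitz.qPoch (y : ℂ)⁻¹ (q : ℂ) k ≠ 0 →
        AlSalamCarlitz.qPoch (q * (t * x)⁻¹) (q : ℂ) k *
          AlSalamCarlitz.qPoch (q * (t * y)⁻¹) (q : ℂ) k ≠ 0) →
      Summable (AlSalamCarlitz.kernelTerm μ q t x y) ∧
      AlSalamCarlitz.qKernel μ q t x y =
        ((√(AlSalamCarlitz.weight μ q x * AlSalamCarlitz.weight μ q y * |x * y|) : ℝ) : ℂ) *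
        (AlSalamCarlitz.qPochInf t (q : ℂ) * AlSalamCarlitz.qPochInf t (q : ℂ) *
            AlSalamCarlitz.qPochInf (-(μ * t)) (q : ℂ) /
          (AlSalamCarlitz.qPochInf (t * x) (q : ℂ) * AlSalamCarlitz.qPochInf (t * y) (q : ℂ))) *
        AlSalamCarlitz.phi32 (x : ℂ)⁻¹ (y : ℂ)⁻¹ (-(q * (μ * t)⁻¹))
          (q * (t * x)⁻¹) (q * (t * y)⁻¹) q q) ∧
    -- the case `x = -μ q^s`
    (x = -μ * q ^ s →
      AlSalamCarlitz.qPochInf (-((μ : ℂ)⁻¹ * t * x)) (q : ℂ) ≠ 0 →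
      AlSalamCarlitz.qPochInf (-((μ : ℂ)⁻¹ * t * y)) (q : ℂ) ≠ 0 →
      (∀ k : ℕ,
        AlSalamCarlitz.qPoch (-(μ * (x : ℂ)⁻¹)) (q : ℂ) k *
          AlSalamCarlitz.qPoch (-(μ * (y : ℂ)⁻¹)) (q : ℂ) k ≠ 0 →
        AlSalamCarlitz.qPoch (-(q * μ * (t * x)⁻¹)) (q : ℂ) k *
          AlSalamCarlitz.qPoch (-(q * μ * (t * y)⁻¹)) (q : ℂ) k ≠ 0) →
      Summable (AlSalamCarlitz.kernelTerm μ q t x y) ∧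
      AlSalamCarlitz.qKernel μ q t x y =
        ((√(AlSalamCarlitz.weight μ q x * AlSalamCarlitz.weight μ q y * |x * y|) : ℝ) : ℂ) *
        (AlSalamCarlitz.qPochInf t (q : ℂ) * AlSalamCarlitz.qPochInf t (q : ℂ) *
            AlSalamCarlitz.qPochInf (-((μ : ℂ)⁻¹ * t)) (q : ℂ) /
          (AlSalamCarlitz.qPochInf (-((μ : ℂ)⁻¹ * t * x)) (q : ℂ) *
            AlSalamCarlitz.qPochInf (-((μ : ℂ)⁻¹ * t * y)) (q : ℂ))) *
        AlSalamCarlitz.phi32 (-(μ * (x : ℂ)⁻¹)) (-(μ * (y : ℂ)⁻¹)) (-(q * μ * t⁻¹))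
          (-(q * μ * (t * x)⁻¹)) (-(q * μ * (t * y)⁻¹)) q q) := by
  refine ⟨fun hx htx hty hden => ?_, fun hx htx hty hden => ?_⟩
  · have hxg : x ∈ AlSalamCarlitz.qGrid μ q := ⟨s, Or.inl hx⟩
    refine ⟨AlSalamCarlitz.summable_kernelTerm hμ hq0 hq1 t hxg hy, ?_⟩
    rw [AlSalamCarlitz.qKernel_eq hμ hq0 hq1 t hxg,
      AlSalamCarlitz.polyKernel_pow_eq hμ hq0 hq1 ht s hx hy htx hty hden]
    exact (mul_assoc _ _ _).symm
  · have hxg : x ∈ AlSalamCarlitz.qGrid μ q := ⟨s, Or.inr hx⟩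
    refine ⟨AlSalamCarlitz.summable_kernelTerm hμ hq0 hq1 t hxg hy, ?_⟩
    -- apply the first case to `μ⁻¹`, `-x / μ`, `-y / μ`
    have hx' : -(μ⁻¹ * x) = q ^ s := by
      rw [hx]
      field_simp
    have a1 : ∀ z : ℝ, t * ((-(μ⁻¹ * z) : ℝ) : ℂ) = -((μ : ℂ)⁻¹ * t * z) := fun z => by
      push_cast
      ring
    have a2 : ∀ z : ℝ, (((-(μ⁻¹ * z) : ℝ) : ℂ))⁻¹ = -(μ * (z : ℂ)⁻¹) := fun z => by
      push_cast
      rw [inv_neg, mul_inv, inv_inv]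
    have a3 : ∀ z : ℝ, (q : ℂ) * (-((μ : ℂ)⁻¹ * t * z))⁻¹ = -(q * μ * (t * z)⁻¹) := fun z => by
      rw [inv_neg, mul_assoc, mul_inv, inv_inv]
      ring
    have a4 : -((q : ℂ) * (((μ⁻¹ : ℝ) : ℂ) * t)⁻¹) = -(q * μ * t⁻¹) := by
      push_cast
      rw [mul_inv, inv_inv]
      ring
    have a5 : -((((μ⁻¹ : ℝ) : ℂ)) * t) = -((μ : ℂ)⁻¹ * t) := by push_cast; rfl
    have key := AlSalamCarlitz.polyKernel_pow_eq (inv_pos.2 hμ) hq0 hq1 ht s hx'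
      (AlSalamCarlitz.neg_inv_mul_mem_qGrid hμ.ne' hy)
      (by rwa [a1]) (by rwa [a1]) (by simpa only [a1, a2, a3] using hden)
    rw [AlSalamCarlitz.qKernel_eq hμ hq0 hq1 t hxg, AlSalamCarlitz.polyKernel_inv hμ hq0, key]
    simp only [a1, a2, a3, a4, a5]
    exact (mul_assoc _ _ _).symm
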